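/- Let $K$ be a field that is finitely generated over its prime field, and let $f$ be an automorphism of the algebraic torus $\mathbb{G}_m^2$ over $K$ (a $K$-automorphism of the variety). Assume that $f$ is loxodromic, i.e. its dynamical degree $\lambda(f)=\lim_{n\to\infty}\deg(f^n)^{1/n}$ is $>1$, where $\deg(f^n)$ is the degree of $f^n$ as a birational self-map of $\mathbb{P}^2\supset\mathbb{G}_m^2$. Let $p\in\mathbb{G}_m^2(K)=K^\times\times K^\times$ be a point that is not $f$-periodic. Then there is an absolute value $|\cdot|$ on $K$ for which the forward orbit $(f^n(p))_{n\ge 0}$ is unbounded in $\mathbb{G}_m^2(K)$: writing $f^n(p)=(x_n,y_n)$, there is no constant $C$ such that $|x_n|,\ |x_n^{-1}|,\ |y_n|,\ |y_n^{-1}|\le C$ for all $n\ge 0$. -/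

import Mathlib

open Filter Topology

noncomputable section

namespace Torus

/-- The coordinate ring `K[x, x⁻¹, y, y⁻¹]` of the split torus `𝔾_m²` over `K`: the group algebra
of the lattice `ℤ × ℤ`, where `(a, b)` stands for the monomial `x ^ a * y ^ b`. -/
abbrev CoordRing (K : Type*) [Field K] : Type _ := AddMonoidAlgebra K (ℤ × ℤ)

/-- An automorphism `f` of the `K`-variety `𝔾_m²`. As `𝔾_m²` is affine, `f` is given by its
comorphism `f^*`, an arbitrary `K`-algebra automorphism of the coordinate ring. The comorphism of
the iterate `f^n` is the `n`-th power of `f^*`. -/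
structure Aut (K : Type*) [Field K] where
  /-- the comorphism `f^*` -/
  comorphism : CoordRing K ≃ₐ[K] CoordRing K

variable {K : Type*} [Field K]

/-- The monomial `x ^ m.1 * y ^ m.2`. -/
def monomial (m : ℤ × ℤ) : CoordRing K := AddMonoidAlgebra.single m 1

/-- The monomial `x ^ m.1 * y ^ m.2` as a unit of the coordinate ring. -/
def monomialUnit (m : ℤ × ℤ) : (CoordRing K)ˣ where
  val := monomial m
  inv := monomial (-m)
  val_inv := by
    simp [monomial, AddMonoidAlgebra.single_mul_single, AddMonoidAlgebra.one_def]
  inv_val := by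
    simp [monomial, AddMonoidAlgebra.single_mul_single, AddMonoidAlgebra.one_def]

variable (K) in
/-- The coordinate function `x`. -/
def coordX : (CoordRing K)ˣ := monomialUnit (1, 0)

variable (K) in
/-- The coordinate function `y`. -/
def coordY : (CoordRing K)ˣ := monomialUnit (0, 1)

/-- Evaluation of regular functions on `𝔾_m²` at the point `p ∈ 𝔾_m²(K) = Kˣ × Kˣ`. -/
def evalAt (p : Kˣ × Kˣ) : CoordRing K →ₐ[K] K :=
  AddMonoidAlgebra.lift K K (ℤ × ℤ)
    { toFun := fun m => ((p.1 ^ m.toAdd.1 * p.2 ^ m.toAdd.2 : Kˣ) : K)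
      map_one' := by simp
      map_mul' := fun m n => by
        rw [← Units.val_mul]
        congr 1
        simp only [toAdd_mul, Prod.fst_add, Prod.snd_add, zpow_add]
        exact mul_mul_mul_comm _ _ _ _ }

/-- The action of an automorphism `f` on `K`-points: the coordinates of `f p` are the values at
`p` of the regular functions `f^* x` and `f^* y`. -/
def Aut.onPoints (f : Aut K) (p : Kˣ × Kˣ) : Kˣ × Kˣ :=
  (Units.map (evalAt p : CoordRing K →* K)
      (Units.map (f.comorphism : CoordRing K →* CoordRing K) (coordX K)),
   Units.map (evalAt p : CoordRing K →* K)
      (Units.map (f.comorphism : CoordRing K →* CoordRing K) (coordY K)))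

/-- The inclusion of the polynomial ring `K[x, y]` in the coordinate ring of `𝔾_m²`. -/
def ofPoly : MvPolynomial (Fin 2) K →ₐ[K] CoordRing K :=
  MvPolynomial.aeval ![(coordX K : CoordRing K), (coordY K : CoordRing K)]

/-- The degree of the rational self-map of `ℙ²` that extends the self-map `(x, y) ↦ (F, G)` of
`𝔾_m² ⊆ 𝔸² ⊆ ℙ²`, that is, the intersection number of a line with the pull-back of a line. It is
the smallest `d` for which this rational map has the form `[C : A : B]` with `A, B, C` homogeneous
of degree `d`; in the affine coordinates `x, y` this means `F = A / C` and `G = B / C` with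
polynomials `A, B, C` of total degree at most `d`. -/
def degreeOf (F G : CoordRing K) : ℕ :=
  sInf {d : ℕ | ∃ A B C : MvPolynomial (Fin 2) K, C ≠ 0 ∧
    A.totalDegree ≤ d ∧ B.totalDegree ≤ d ∧ C.totalDegree ≤ d ∧
    ofPoly C * F = ofPoly A ∧ ofPoly C * G = ofPoly B}

/-- The degree of the iterate `f^n` as a birational self-map of `ℙ²`. -/
def Aut.iterDegree (f : Aut K) (n : ℕ) : ℕ :=
  degreeOf ((f.comorphism ^ n) (coordX K)) ((f.comorphism ^ n) (coordY K))

/-- `l` is the dynamical degree of `f`, that is, the limit of `deg (f^n) ^ (1 / n)`. -/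
def Aut.HasDynamicalDegree (f : Aut K) (l : ℝ) : Prop :=
  Tendsto (fun n : ℕ => (f.iterDegree n : ℝ) ^ (1 / (n : ℝ))) atTop (𝓝 l)

/-- `f` is loxodromic: its dynamical degree is greater than `1`. -/
def Aut.IsLoxodromic (f : Aut K) : Prop :=
  ∃ l : ℝ, 1 < l ∧ f.HasDynamicalDegree l

/-- A set of points of `𝔾_m²(K)` is bounded for the absolute value `v` if the functions
`x, x⁻¹, y, y⁻¹`, which embed `𝔾_m²` as a closed subvariety of `𝔸⁴`, are bounded on it. -/
def IsBoundedFor (v : AbsoluteValue K ℝ) (S : Set (Kˣ × Kˣ)) : Prop :=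
  ∃ C : ℝ, ∀ q ∈ S, v (q.1 : K) ≤ C ∧ v ((q.1⁻¹ : Kˣ) : K) ≤ C ∧
    v (q.2 : K) ≤ C ∧ v ((q.2⁻¹ : Kˣ) : K) ≤ C

end Torus

end

/-! Units of the Laurent polynomial ring are monomials, so `f` is `q ↦ c * M q` with `M ∈ GL₂(ℤ)`
(`exists_matrix`). If an eigenvalue of `M` were a root of unity, some power of `M` would be
unipotent and degrees would grow at most linearly along its powers; so loxodromy makes `M`
hyperbolic (`Aut.IsLoxodromic.isHyperbolic`).

Suppose the orbit of `p` is bounded for every absolute value. The quotients `f^(n+1)(p) / f^n(p)`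
are bounded too, and they equal `M^n u` with `u = f(p) / p`, since `c` cancels. For a discrete
absolute value a bounded orbit has finitely many values, so hyperbolicity forces both coordinates of
`u` to have absolute value `1` (`eq_one_of_isBoundedFor`). Embedding `K` in an algebraic closure of
`F((X))`, with `F` the prime field, then rules out transcendental coordinates. So `u` is defined
over a finite field or a number field; in the latter case the points `M^n u` have integral
coordinates with bounded conjugates, hence are finite in number (`finite_of_isBoundedFor`).

A finite orbit makes `u` torsion, and then `p` is periodic (`mem_periodicPts_of_finite`). -/

noncomputable section

namespace Torus

/-! ### Monomial maps on pairs in a commutative group -/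

section MonomialAction

variable {H H' : Type*} [CommGroup H] [CommGroup H']

/-- The action of integral `2 × 2` matrices on pairs of elements of a commutative group by
monomial maps. -/
def act (M : Matrix (Fin 2) (Fin 2) ℤ) : H × H →* H × H where
  toFun q := (q.1 ^ M 0 0 * q.2 ^ M 0 1, q.1 ^ M 1 0 * q.2 ^ M 1 1)
  map_one' := by simp
  map_mul' q r := by
    ext <;> simp only [Prod.fst_mul, Prod.snd_mul, mul_zpow] <;> exact mul_mul_mul_comm _ _ _ _

theorem act_apply (M : Matrix (Fin 2) (Fin 2) ℤ) (q : H × H) :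
    act M q = (q.1 ^ M 0 0 * q.2 ^ M 0 1, q.1 ^ M 1 0 * q.2 ^ M 1 1) := rfl

@[simp]
theorem act_one (q : H × H) : act 1 q = q := by
  ext <;> simp [act_apply]

theorem act_mul (M N : Matrix (Fin 2) (Fin 2) ℤ) (q : H × H) :
    act (M * N) q = act M (act N q) := by
  ext <;> simp only [act_apply, Matrix.mul_apply, Fin.sum_univ_two, mul_zpow, zpow_add, ← zpow_mul]
    <;> simp only [mul_comm (M _ _)] <;> exact mul_mul_mul_comm _ _ _ _

theorem act_sub (M N : Matrix (Fin 2) (Fin 2) ℤ) (q : H × H) :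
    act (M - N) q = act M q / act N q := by
  ext <;> simp only [act_apply, Matrix.sub_apply, zpow_sub, Prod.fst_div, Prod.snd_div] <;>
    simp only [div_eq_mul_inv, mul_inv] <;> exact mul_mul_mul_comm _ _ _ _

theorem act_smul_one (d : ℤ) (q : H × H) :
    act (d • (1 : Matrix (Fin 2) (Fin 2) ℤ)) q = q ^ d := by
  ext <;> simp only [act_apply, Matrix.smul_apply] <;> simp

theorem map_act (g : H →* H') (M : Matrix (Fin 2) (Fin 2) ℤ) (q : H × H) :
    Prod.map g g (act M q) = act M (Prod.map g g q) := by
  ext <;> simp [act_apply]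

theorem act_pow_succ (M : Matrix (Fin 2) (Fin 2) ℤ) (n : ℕ) (q : H × H) :
    act (M ^ (n + 1)) q = act M (act (M ^ n) q) := by
  rw [pow_succ', act_mul]

theorem act_injective {M : Matrix (Fin 2) (Fin 2) ℤ} (hM : IsUnit M) :
    Function.Injective (act M : H × H →* H × H) := by
  obtain ⟨N, hN⟩ := hM.exists_left_inv
  intro q r h
  rw [← act_one q, ← act_one r, ← hN, act_mul, act_mul, h]

/-- A matrix is hyperbolic here if none of its eigenvalues is a root of unity. -/
def IsHyperbolic (M : Matrix (Fin 2) (Fin 2) ℤ) : Prop :=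
  ∀ k : ℕ, 0 < k → (M ^ k - 1).det ≠ 0

/-- The adjugate of `M` times `M` is the scalar `M.det`, which acts as a power map. -/
theorem zpow_det_eq_one {M : Matrix (Fin 2) (Fin 2) ℤ} {q : H × H} (h : act M q = 1) :
    q ^ M.det = 1 := by
  rw [← act_smul_one, ← Matrix.adjugate_mul, act_mul, h, map_one]

theorem exists_period_of_finite {M : Matrix (Fin 2) (Fin 2) ℤ} (hM : IsUnit M) {u : H × H}
    (hu : (Set.range fun n : ℕ => act (M ^ n) u).Finite) :
    ∃ k : ℕ, 0 < k ∧ act (M ^ k) u = u := by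
  obtain ⟨i, j, hij, h⟩ : ∃ i j : ℕ, i < j ∧ act (M ^ i) u = act (M ^ j) u := by
    obtain ⟨i, -, j, -, hne, h⟩ := Set.infinite_univ.exists_ne_map_eq_of_mapsTo
      (f := fun n : ℕ => act (M ^ n) u) (fun n _ => Set.mem_range_self n) hu
    rcases lt_or_gt_of_ne hne with h' | h'
    exacts [⟨i, j, h', h⟩, ⟨j, i, h', h.symm⟩]
  refine ⟨j - i, by omega, act_injective (hM.pow i) ?_⟩
  rw [← act_mul, ← pow_add, Nat.add_sub_cancel' hij.le, h]

/-- `M ^ k - 1` kills `u`, hence so does its determinant, which is nonzero by hyperbolicity. -/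
theorem exists_pow_eq_one {M : Matrix (Fin 2) (Fin 2) ℤ} (hM : IsHyperbolic M) {u : H × H}
    {k : ℕ} (hk : 0 < k) (hu : act (M ^ k) u = u) : ∃ d : ℕ, 0 < d ∧ u ^ d = 1 := by
  refine ⟨(M ^ k - 1).det.natAbs, Int.natAbs_pos.mpr (hM k hk), ?_⟩
  rw [pow_natAbs_eq_one]
  exact zpow_det_eq_one (by rw [act_sub, hu, act_one, div_self'])

/-- If the successive quotients of an orbit of an affine monomial map take finitely many values,
then the orbit is periodic. -/
theorem mem_periodicPts_of_finite {M : Matrix (Fin 2) (Fin 2) ℤ} (hM : IsUnit M)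
    (hyp : IsHyperbolic M) {g : H × H → H × H} {c : H × H} (hg : ∀ q, g q = c * act M q)
    (p : H × H) (hfin : (Set.range fun n : ℕ => act (M ^ n) (g p / p)).Finite) :
    p ∈ Function.periodicPts g := by
  obtain ⟨k, hk, hper⟩ := exists_period_of_finite hM hfin
  obtain ⟨d, hd, hpow⟩ := exists_pow_eq_one hyp hk hper
  have hgn (n : ℕ) (q w : H × H) : g^[n] (q * w) = g^[n] q * act (M ^ n) w := by
    induction n with
    | zero => simp
    | succ n ih =>
      rw [Function.iterate_succ_apply', Function.iterate_succ_apply', ih, hg, hg, map_mul,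
        act_pow_succ, mul_assoc]
  -- `w` is the product of the first `n` quotients `act (M ^ i) (g p / p)`; each of them is
  -- `d`-torsion and fixed by `M ^ k`.
  have hw (n : ℕ) : ∃ w, g^[n] p = p * w ∧ w ^ d = 1 ∧ act (M ^ k) w = w := by
    induction n with
    | zero => exact ⟨1, by simp⟩
    | succ n ih =>
      obtain ⟨w, h, hwd, hwk⟩ := ih
      refine ⟨w * act (M ^ n) (g p / p), ?_, ?_, ?_⟩
      · have h1 : g p = p * (g p / p) := by simp
        rw [Function.iterate_succ_apply, h1, hgn, h, mul_assoc, ← h1]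
      · rw [mul_pow, hwd, ← map_pow, hpow, map_one, one_mul]
      · rw [map_mul, hwk, ← act_mul, ← pow_add, add_comm, pow_add, act_mul, hper]
  obtain ⟨w, h, hwd, hwk⟩ := hw k
  -- As `M ^ k` fixes `w`, each further application of `g^[k]` contributes the same factor `w`, so
  -- `k * d` is a period.
  have hj (j : ℕ) : g^[k * j] p = p * w ^ j := by
    induction j with
    | zero => simp
    | succ j ih =>
      rw [mul_add, mul_one, add_comm, Function.iterate_add_apply, ih, hgn, h, map_pow, hwk,
        pow_succ', mul_assoc]
  refine Function.mk_mem_periodicPts (Nat.mul_pos hk hd) ?_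
  rw [Function.IsPeriodicPt, Function.IsFixedPt, hj, hwd, mul_one]

end MonomialAction

/-! ### Units of the coordinate ring -/

section Units

variable {K : Type*} [Field K]

/-- `ℤ × ℤ` has two unique sums: if `F` had two terms, two distinct pairs of exponents would have
uniquely represented sums. The product has nonzero coefficients there, so both sums are `0`, against
uniqueness. -/
theorem exists_eq_single_of_mul_eq_one {F G : CoordRing K} (h : F * G = 1) :
    ∃ (m : ℤ × ℤ) (c : K), F = AddMonoidAlgebra.single m c := by
  have hF : F ≠ 0 := left_ne_zero_of_mul_eq_one h
  have hG : G ≠ 0 := right_ne_zero_of_mul_eq_one h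
  have hGs : 0 < G.coeff.support.card := by
    rwa [Finset.card_pos, Finsupp.support_nonempty_iff, ne_eq, AddMonoidAlgebra.coeff_eq_zero]
  have hcard : F.coeff.support.card ≤ 1 := by
    by_contra! hlt
    obtain ⟨p, hp, q, hq, hne, hup, huq⟩ := TwoUniqueSums.uniqueAdd_of_one_lt_card
      (A := F.coeff.support) (B := G.coeff.support) (Nat.one_lt_mul_iff.mpr ⟨by omega, hGs, .inl hlt⟩)
    have hzero (r : (ℤ × ℤ) × (ℤ × ℤ)) (hr : r ∈ F.coeff.support ×ˢ G.coeff.support)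
        (hur : UniqueAdd F.coeff.support G.coeff.support r.1 r.2) : r.1 + r.2 = 0 := by
      have h1 := AddMonoidAlgebra.coeff_mul_add_of_uniqueAdd hur
      rw [Finset.mem_product, Finsupp.mem_support_iff, Finsupp.mem_support_iff] at hr
      by_contra h0
      rw [h, AddMonoidAlgebra.one_def, AddMonoidAlgebra.coeff_single,
        Finsupp.single_eq_of_ne h0] at h1
      exact mul_ne_zero hr.1 hr.2 h1.symm
    rw [Finset.mem_product] at hq
    have := hup hq.1 hq.2 ((hzero q (Finset.mem_product.mpr hq) huq).trans (hzero p hp hup).symm)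
    exact hne (Prod.ext this.1.symm this.2.symm)
  obtain ⟨m, c, hmc⟩ := Finsupp.card_support_le_one'.mp hcard
  exact ⟨m, c, AddMonoidAlgebra.coeff_injective hmc⟩

/-- The coordinates `(x, y)` as a pair of units. -/
def coords (K : Type*) [Field K] : (CoordRing K)ˣ × (CoordRing K)ˣ := (coordX K, coordY K)

/-- The constants as units of the coordinate ring. -/
def const : Kˣ →* (CoordRing K)ˣ := Units.map (algebraMap K (CoordRing K) : K →* CoordRing K)

theorem monomialUnit_add (m n : ℤ × ℤ) :
    (monomialUnit (m + n) : (CoordRing K)ˣ) = monomialUnit m * monomialUnit n := by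
  ext1
  simp [monomialUnit, monomial, AddMonoidAlgebra.single_mul_single]

theorem monomialUnit_zero : (monomialUnit 0 : (CoordRing K)ˣ) = 1 := rfl

theorem monomialUnit_zsmul (k : ℤ) (m : ℤ × ℤ) :
    (monomialUnit (k • m) : (CoordRing K)ˣ) = monomialUnit m ^ k := by
  let g : ℤ × ℤ →+ Additive (CoordRing K)ˣ :=
    { toFun := fun m => .ofMul (monomialUnit m)
      map_zero' := congrArg Additive.ofMul monomialUnit_zero
      map_add' := fun m n => congrArg Additive.ofMul (monomialUnit_add m n) }
  exact congrArg Additive.toMul (map_zsmul g k m)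

theorem monomialUnit_eq (m : ℤ × ℤ) :
    (monomialUnit m : (CoordRing K)ˣ) = coordX K ^ m.1 * coordY K ^ m.2 := by
  rw [coordX, coordY, ← monomialUnit_zsmul, ← monomialUnit_zsmul, ← monomialUnit_add]
  simp

theorem coe_const_mul_monomialUnit (c : Kˣ) (m : ℤ × ℤ) :
    ((const c * monomialUnit m : (CoordRing K)ˣ) : CoordRing K) =
      AddMonoidAlgebra.single m (c : K) := by
  simp [const, monomialUnit, monomial, AddMonoidAlgebra.single_mul_single]

theorem exists_eq_const_mul_monomialUnit (w : (CoordRing K)ˣ) :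
    ∃ (c : Kˣ) (m : ℤ × ℤ), w = const c * monomialUnit m := by
  obtain ⟨m, c, h⟩ := exists_eq_single_of_mul_eq_one w.mul_inv
  have hc : c ≠ 0 := by
    rintro rfl
    exact w.ne_zero (by rw [h, AddMonoidAlgebra.single_zero])
  exact ⟨Units.mk0 c hc, m, by ext1; rw [coe_const_mul_monomialUnit, h, Units.val_mk0]⟩

theorem exists_eq_const_mul_act (w : (CoordRing K)ˣ × (CoordRing K)ˣ) :
    ∃ (c : Kˣ × Kˣ) (M : Matrix (Fin 2) (Fin 2) ℤ),
      w = Prod.map const const c * act M (coords K) := by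
  obtain ⟨c₁, m₁, h₁⟩ := exists_eq_const_mul_monomialUnit w.1
  obtain ⟨c₂, m₂, h₂⟩ := exists_eq_const_mul_monomialUnit w.2
  refine ⟨(c₁, c₂), !![m₁.1, m₁.2; m₂.1, m₂.2], Prod.ext ?_ ?_⟩
  · simp [act_apply, coords, h₁, monomialUnit_eq]
  · simp [act_apply, coords, h₂, monomialUnit_eq]

theorem eq_one_of_const_mul_act {c : Kˣ × Kˣ} {M : Matrix (Fin 2) (Fin 2) ℤ}
    (h : Prod.map const const c * act M (coords K) = coords K) : M = 1 := by
  have key (c : Kˣ) (m n : ℤ × ℤ)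
      (h : (const c * monomialUnit m : (CoordRing K)ˣ) = monomialUnit n) : m = n := by
    have h' := congrArg (Units.val : (CoordRing K)ˣ → CoordRing K) h
    rw [coe_const_mul_monomialUnit] at h'
    have h2 := congrArg (fun F : CoordRing K => F.coeff m) h'
    by_contra hne
    simp [monomialUnit, monomial, Ne.symm hne] at h2
  have h1 := key c.1 (M 0 0, M 0 1) (1, 0)
    (by simpa [act_apply, coords, monomialUnit_eq] using congrArg Prod.fst h)
  have h2 := key c.2 (M 1 0, M 1 1) (0, 1)
    (by simpa [act_apply, coords, monomialUnit_eq] using congrArg Prod.snd h)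
  simp only [Prod.mk.injEq] at h1 h2
  ext i j
  fin_cases i <;> fin_cases j <;> simp [h1, h2]

end Units

/-! ### Automorphisms as affine monomial maps -/

section Aut

variable {K : Type*} [Field K]

/-- The action of an algebra automorphism of the coordinate ring on pairs of units. -/
def pull (φ : CoordRing K ≃ₐ[K] CoordRing K) (w : (CoordRing K)ˣ × (CoordRing K)ˣ) :
    (CoordRing K)ˣ × (CoordRing K)ˣ :=
  Prod.map (Units.map (φ : CoordRing K →* CoordRing K))
    (Units.map (φ : CoordRing K →* CoordRing K)) w

theorem pull_const_mul_act (φ : CoordRing K ≃ₐ[K] CoordRing K) (c : Kˣ × Kˣ)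
    (M : Matrix (Fin 2) (Fin 2) ℤ) (w : (CoordRing K)ˣ × (CoordRing K)ˣ) :
    pull φ (Prod.map const const c * act M w) = Prod.map const const c * act M (pull φ w) := by
  have hc (a : Kˣ) : Units.map (φ : CoordRing K →* CoordRing K) (const a) = const a := by
    ext1
    exact φ.commutes a
  unfold pull
  rw [← map_act]
  ext1 <;> simp [hc]

/-- An automorphism of the torus is the composition of a translation and an invertible monomial
map. -/
theorem exists_matrix (f : Aut K) : ∃ (c : Kˣ × Kˣ) (M : Matrix (Fin 2) (Fin 2) ℤ), IsUnit M ∧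
    pull f.comorphism (coords K) = Prod.map const const c * act M (coords K) := by
  obtain ⟨c, M, h⟩ := exists_eq_const_mul_act (pull f.comorphism (coords K))
  obtain ⟨d, N, h'⟩ := exists_eq_const_mul_act (pull f.comorphism.symm (coords K))
  refine ⟨c, M, ?_, h⟩
  -- Expanding this composition gives a monomial expression of the coordinates with matrix `N * M`,
  -- which must be `1`.
  have h2 : pull f.comorphism (pull f.comorphism.symm (coords K)) = coords K := by
    ext <;> simp [pull]
  rw [h', pull_const_mul_act, h, map_mul, ← map_act, ← act_mul, ← mul_assoc] at h2
  have := eq_one_of_const_mul_act (c := d * act N c) (M := N * M)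
    (by
      conv_rhs => rw [← h2]
      congr 1
      ext1 <;> simp)
  exact IsUnit.of_mul_eq_one_right _ this

theorem exists_pull_pow {f : Aut K} {c : Kˣ × Kˣ} {M : Matrix (Fin 2) (Fin 2) ℤ}
    (h : pull f.comorphism (coords K) = Prod.map const const c * act M (coords K)) (n : ℕ) :
    ∃ d : Kˣ × Kˣ, pull (f.comorphism ^ n) (coords K) =
      Prod.map const const d * act (M ^ n) (coords K) := by
  induction n with
  | zero => exact ⟨1, by ext <;> simp [pull]⟩
  | succ n ih =>
    obtain ⟨d, hd⟩ := ih
    refine ⟨d * act (M ^ n) c, ?_⟩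
    have h1 : pull (f.comorphism ^ (n + 1)) (coords K) =
        pull f.comorphism (pull (f.comorphism ^ n) (coords K)) := by
      rw [pow_succ']
      rfl
    rw [h1, hd, pull_const_mul_act, h, map_mul, ← map_act, pow_succ, act_mul, ← mul_assoc]
    congr 1
    ext1 <;> simp

theorem evalAt_coords (p : Kˣ × Kˣ) :
    Prod.map (Units.map (evalAt p : CoordRing K →* K)) (Units.map (evalAt p : CoordRing K →* K))
      (coords K) = p := by
  ext <;> simp [coords, coordX, coordY, monomialUnit, monomial, evalAt]

theorem onPoints_eq {f : Aut K} {c : Kˣ × Kˣ} {M : Matrix (Fin 2) (Fin 2) ℤ}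
    (h : pull f.comorphism (coords K) = Prod.map const const c * act M (coords K))
    (p : Kˣ × Kˣ) : f.onPoints p = c * act M p := by
  have h1 : f.onPoints p = Prod.map (Units.map (evalAt p : CoordRing K →* K))
      (Units.map (evalAt p : CoordRing K →* K)) (pull f.comorphism (coords K)) := rfl
  have hc (a : Kˣ) : Units.map (evalAt p : CoordRing K →* K) (const a) = a := by
    ext1
    exact (evalAt p).commutes a
  conv_rhs => rw [← evalAt_coords p, ← map_act]
  rw [h1, h]
  ext1 <;> simp [hc]

end Aut

/-! ### Degree growth and hyperbolicity -/

section Degree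

variable {K : Type*} [Field K]

theorem ofPoly_monomial (i j : ℕ) (c : K) :
    ofPoly (MvPolynomial.C c * MvPolynomial.X 0 ^ i * MvPolynomial.X 1 ^ j) =
      AddMonoidAlgebra.single ((i : ℤ), (j : ℤ)) c := by
  simp [ofPoly, coordX, coordY, monomialUnit, monomial, AddMonoidAlgebra.single_mul_single,
    AddMonoidAlgebra.single_pow]

theorem totalDegree_monomial_le (i j : ℕ) (c : K) :
    (MvPolynomial.C c * MvPolynomial.X 0 ^ i * MvPolynomial.X 1 ^ j :
      MvPolynomial (Fin 2) K).totalDegree ≤ i + j := by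
  refine (MvPolynomial.totalDegree_mul _ _).trans ?_
  refine add_le_add ((MvPolynomial.totalDegree_mul _ _).trans ?_) ?_ <;> simp

/-- The sum of the absolute values of the entries of a matrix. -/
def entrySum (M : Matrix (Fin 2) (Fin 2) ℤ) : ℕ := ∑ i, ∑ j, (M i j).natAbs

theorem degreeOf_le (m n : ℤ × ℤ) (a b : K) :
    degreeOf (AddMonoidAlgebra.single m a) (AddMonoidAlgebra.single n b) ≤
      2 * (m.1.natAbs + m.2.natAbs + n.1.natAbs + n.2.natAbs) := by
  -- The common denominator `x ^ i * y ^ j` clears every negative exponent of both monomials.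
  set i := m.1.natAbs + n.1.natAbs with hi
  set j := m.2.natAbs + n.2.natAbs with hj
  refine Nat.sInf_le ⟨MvPolynomial.C a * MvPolynomial.X 0 ^ (i + m.1).toNat *
    MvPolynomial.X 1 ^ (j + m.2).toNat, MvPolynomial.C b * MvPolynomial.X 0 ^ (i + n.1).toNat *
    MvPolynomial.X 1 ^ (j + n.2).toNat, MvPolynomial.C 1 * MvPolynomial.X 0 ^ i *
    MvPolynomial.X 1 ^ j, ?_, ?_, ?_, ?_, ?_, ?_⟩
  · intro h
    have := ofPoly_monomial (K := K) i j 1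
    rw [h, map_zero] at this
    exact one_ne_zero (AddMonoidAlgebra.single_eq_zero.mp this.symm)
  · exact (totalDegree_monomial_le _ _ _).trans (by omega)
  · exact (totalDegree_monomial_le _ _ _).trans (by omega)
  · exact (totalDegree_monomial_le _ _ _).trans (by omega)
  all_goals
    rw [ofPoly_monomial, ofPoly_monomial, AddMonoidAlgebra.single_mul_single, one_mul]
    congr 1
    ext <;> simp <;> omega

theorem iterDegree_le {f : Aut K} {n : ℕ} {d : Kˣ × Kˣ} {M : Matrix (Fin 2) (Fin 2) ℤ}
    (h : pull (f.comorphism ^ n) (coords K) = Prod.map const const d * act M (coords K)) :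
    f.iterDegree n ≤ 2 * entrySum M := by
  have h1 := congrArg (fun w => (w.1 : CoordRing K)) h
  have h2 := congrArg (fun w => (w.2 : CoordRing K)) h
  have e1 : (f.comorphism ^ n) (coordX K) = AddMonoidAlgebra.single (M 0 0, M 0 1) (d.1 : K) := by
    rw [← coe_const_mul_monomialUnit, monomialUnit_eq]
    exact h1
  have e2 : (f.comorphism ^ n) (coordY K) = AddMonoidAlgebra.single (M 1 0, M 1 1) (d.2 : K) := by
    rw [← coe_const_mul_monomialUnit, monomialUnit_eq]
    exact h2
  rw [Aut.iterDegree, e1, e2]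
  refine (degreeOf_le _ _ _ _).trans (le_of_eq ?_)
  simp [entrySum, Fin.sum_univ_two, add_assoc]

theorem entrySum_add_le (M N : Matrix (Fin 2) (Fin 2) ℤ) :
    entrySum (M + N) ≤ entrySum M + entrySum N := by
  simp only [entrySum, ← Finset.sum_add_distrib]
  gcongr
  exact Int.natAbs_add_le _ _

theorem entrySum_nsmul (k : ℕ) (M : Matrix (Fin 2) (Fin 2) ℤ) :
    entrySum (k • M) = k * entrySum M := by
  simp only [entrySum, Finset.mul_sum]
  simp [Int.natAbs_mul]

/-- Determinant `1` and eigenvalue `1` force trace `2`, so the characteristic polynomial is `(X - 1)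
^ 2`. -/
theorem sq_sub_one_eq_zero {N : Matrix (Fin 2) (Fin 2) ℤ} (h1 : N.det = 1)
    (h2 : (N - 1).det = 0) : (N - 1) * (N - 1) = 0 := by
  rw [Matrix.det_fin_two] at h1 h2
  simp at h2
  have ht : N 0 0 + N 1 1 = 2 := by linarith
  ext i j
  fin_cases i <;> fin_cases j <;> simp [Matrix.mul_apply, Fin.sum_univ_two] <;> grind

theorem pow_eq_one_add_nsmul {R : Type*} [Ring R] {N : R} (h : (N - 1) * (N - 1) = 0) (j : ℕ) :
    N ^ j = 1 + j • (N - 1) := by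
  induction j with
  | zero => simp
  | succ j ih =>
    have hN : N ^ (j + 1) = (1 + j • (N - 1)) * (1 + (N - 1)) := by
      rw [pow_succ, ih, add_sub_cancel]
    rw [hN, mul_add, add_mul _ _ (N - 1), smul_mul_assoc, h, smul_zero, mul_one, one_mul, add_zero,
      succ_nsmul, add_assoc]

/-- For `1 < r < l`, eventually `r ^ (k * j) < d (k * j)`, whereas `a + j * b` is eventually below
`r ^ j`. -/
theorem not_linear_bound {d : ℕ → ℕ} {l : ℝ} (hl : 1 < l)
    (hd : Tendsto (fun n : ℕ => (d n : ℝ) ^ (1 / (n : ℝ))) atTop (𝓝 l)) {k : ℕ} (hk : 0 < k)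
    (a b : ℕ) (hbound : ∀ j : ℕ, d (k * j) ≤ a + j * b) : False := by
  obtain ⟨r, hr1, hrl⟩ := exists_between hl
  have hev : ∀ᶠ n : ℕ in atTop, r < (d n : ℝ) ^ (1 / (n : ℝ)) := hd.eventually (lt_mem_nhds hrl)
  have hsub : Tendsto (fun j : ℕ => k * j) atTop atTop :=
    tendsto_id.const_mul_atTop' hk
  have hlim : Tendsto (fun j : ℕ => ((a + j * b : ℕ) : ℝ) / r ^ j) atTop (𝓝 0) := by
    have h1 := (tendsto_pow_const_div_const_pow_of_one_lt 0 hr1).const_mul (a : ℝ)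
    have h2 := (tendsto_pow_const_div_const_pow_of_one_lt 1 hr1).const_mul (b : ℝ)
    have h3 := h1.add h2
    simp only [mul_zero, add_zero] at h3
    refine h3.congr fun j => ?_
    push_cast
    ring
  obtain ⟨j, h1, h2, h3⟩ := ((hsub.eventually hev).and
    ((hlim.eventually (gt_mem_nhds one_pos)).and (eventually_gt_atTop 0))).exists
  have hr0 : 0 < r := by linarith
  rw [div_lt_one (by positivity)] at h2
  have hn : 0 < k * j := Nat.mul_pos hk h3
  have h4 : r ^ (k * j) < d (k * j) := by
    calc r ^ (k * j) < ((d (k * j) : ℝ) ^ (1 / ((k * j : ℕ) : ℝ))) ^ (k * j) :=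
          pow_lt_pow_left₀ h1 hr0.le hn.ne'
      _ = d (k * j) := by
          rw [one_div, Real.rpow_inv_natCast_pow (by positivity) hn.ne']
  have h5 : r ^ j ≤ r ^ (k * j) := pow_le_pow_right₀ hr1.le (Nat.le_mul_of_pos_left j hk)
  have h6 : (d (k * j) : ℝ) ≤ ((a + j * b : ℕ) : ℝ) := by exact_mod_cast hbound j
  linarith

theorem Aut.IsLoxodromic.isHyperbolic {f : Aut K} (hf : f.IsLoxodromic) {c : Kˣ × Kˣ}
    {M : Matrix (Fin 2) (Fin 2) ℤ} (hM : IsUnit M)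
    (h : pull f.comorphism (coords K) = Prod.map const const c * act M (coords K)) :
    IsHyperbolic M := by
  intro k hk h0
  obtain ⟨l, hl, hd⟩ := hf
  -- `M` has determinant `±1`; the even exponent makes it `1` and keeps the eigenvalue `1` of `M ^
  -- k`.
  set N := M ^ (2 * k) with hN
  have h1 : N.det = 1 := by
    rw [hN, Matrix.det_pow, pow_mul, Int.isUnit_sq ((Matrix.isUnit_iff_isUnit_det M).mp hM),
      one_pow]
  have h2 : (N - 1).det = 0 := by
    have : N - 1 = (M ^ k - 1) * (M ^ k + 1) := by
      rw [hN, mul_comm 2 k, pow_mul]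
      noncomm_ring
    rw [this, Matrix.det_mul, h0, zero_mul]
  refine not_linear_bound hl hd (k := 2 * k) (by omega) (2 * entrySum 1) (2 * entrySum (N - 1))
    fun j => ?_
  obtain ⟨d, hd⟩ := exists_pull_pow h (2 * k * j)
  refine (iterDegree_le hd).trans ?_
  rw [pow_mul, ← hN, pow_eq_one_add_nsmul (sq_sub_one_eq_zero h1 h2)]
  calc 2 * entrySum (1 + j • (N - 1)) ≤ 2 * (entrySum 1 + entrySum (j • (N - 1))) := by
        gcongr
        exact entrySum_add_le _ _
    _ = 2 * entrySum 1 + j * (2 * entrySum (N - 1)) := by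
        rw [entrySum_nsmul]
        ring

end Degree

/-! ### Embeddings of countable fields -/

section Embeddings

open Cardinal in
-- Countability is all that the proof takes from finite generation; it allows embeddings into large
-- algebraically closed fields.
theorem countable_of_closure_finset {K : Type*} [Field K]
    (hK : ∃ s : Finset K, Subfield.closure (s : Set K) = ⊤) : Countable K := by
  obtain ⟨s, hs⟩ := hK
  have h := Subfield.cardinalMk_closure_le_max (s : Set K)
  rw [hs] at h
  have h1 : #(⊤ : Subfield K) = #K := mk_congr Subfield.topEquiv.toEquiv
  rw [← mk_le_aleph0_iff, ← h1]
  exact h.trans (max_le (mk_le_aleph0_iff.mpr inferInstance) le_rfl)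

open Cardinal in
/-- A countable field embeds in every uncountable algebraically closed field that contains a given
countable subring of it. -/
theorem nonempty_algHom_of_uncountable (R : Type*) {K Ω : Type*} [CommRing R] [IsDomain R]
    [Countable R] [Field K] [Countable K] [Algebra R K] [FaithfulSMul R K] [Field Ω]
    [IsAlgClosed Ω] [Uncountable Ω] [Algebra R Ω] [FaithfulSMul R Ω] :
    Nonempty (K →ₐ[R] Ω) := by
  obtain ⟨s, hs⟩ := exists_isTranscendenceBasis R K
  obtain ⟨t, ht⟩ := exists_isTranscendenceBasis R Ω
  -- Over the countable ring `R`, a transcendence basis of the uncountable `Ω` has the cardinality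
  -- of `Ω`, so it has room for the countable basis `s`.
  have hcard := IsAlgClosed.cardinal_eq_cardinal_transcendence_basis_of_aleph0_lt _ ht
    (mk_le_aleph0_iff.mpr inferInstance) (aleph0_lt_mk_iff.mpr inferInstance)
  have ht' : Uncountable t := by
    rw [← aleph0_lt_mk_iff, ← lift_injective hcard]
    exact aleph0_lt_mk_iff.mpr inferInstance
  obtain ⟨e⟩ : Nonempty (s ↪ t) := by
    rw [← lift_mk_le']
    exact (lift_le_aleph0.mpr (mk_le_aleph0_iff.mpr inferInstance)).trans
      (aleph0_le_lift.mpr (aleph0_lt_mk_iff.mpr ht').le)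
  have hw : AlgebraicIndependent R (((↑) : t → Ω) ∘ e) := ht.1.comp e e.injective
  let A := Algebra.adjoin R (Set.range ((↑) : s → K))
  have hA : Algebra.IsAlgebraic A K := hs.isAlgebraic
  -- `g` sends `s` into `t` along `e`; it extends to `K`, which is algebraic over `A`, because `Ω`
  -- is algebraically closed.
  let g : A →ₐ[R] Ω := (MvPolynomial.aeval (((↑) : t → Ω) ∘ e)).comp hs.1.repr
  have hg : Function.Injective g := by
    change Function.Injective (MvPolynomial.aeval _ ∘ hs.1.aevalEquiv.symm)
    exact Function.Injective.comp hw hs.1.aevalEquiv.symm.injective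
  let := g.toRingHom.toAlgebra
  have : IsScalarTower R A Ω := IsScalarTower.of_algebraMap_eq fun r => (g.commutes r).symm
  have : FaithfulSMul A Ω := (faithfulSMul_iff_algebraMap_injective A Ω).mpr hg
  exact ⟨(IsAlgClosed.lift : K →ₐ[A] Ω).restrictScalars R⟩

end Embeddings

/-! ### Discrete absolute values and transcendental elements -/

section Discrete

/-- Every value of `v` on nonzero elements has a power that is an integral power of a fixed real
number `c > 1`. -/
def HasDiscretePowers {K : Type*} [Field K] (v : AbsoluteValue K ℝ) : Prop :=
  ∃ c : ℝ, 1 < c ∧ ∀ x : K, x ≠ 0 → ∃ N : ℕ, 0 < N ∧ ∃ n : ℤ, v x ^ N = c ^ n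

theorem HasDiscretePowers.comp {K Ω : Type*} [Field K] [Field Ω] {v : AbsoluteValue Ω ℝ}
    (hv : HasDiscretePowers v) (σ : K →+* Ω) : HasDiscretePowers (v.comp σ.injective) := by
  obtain ⟨c, hc, h⟩ := hv
  exact ⟨c, hc, fun x hx => h (σ x) ((map_ne_zero σ).mpr hx)⟩

/-- The spectral norm as an absolute value. -/
def spectralAbs (L Ω : Type*) [NontriviallyNormedField L] [IsUltrametricDist L] [CompleteSpace L]
    [Field Ω] [Algebra L Ω] [Algebra.IsAlgebraic L Ω] : AbsoluteValue Ω ℝ where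
  toFun := spectralNorm L Ω
  map_mul' x y := map_mul (spectralMulAlgNorm L Ω) x y
  nonneg' _ := spectralNorm_nonneg _
  eq_zero' _ := map_eq_zero_iff_eq_zero (spectralMulAlgNorm L Ω)
  add_le' x y := map_add_le_add (spectralMulAlgNorm L Ω) x y

/-- The spectral norm of `x` is the root of order `deg (minpoly L x)` of the norm of the constant
coefficient. This degree serves as the exponent `N`, which therefore depends on `x`. -/
theorem hasDiscretePowers_spectralAbs {L Ω : Type*} [NontriviallyNormedField L]
    [IsUltrametricDist L] [CompleteSpace L] [Field Ω] [Algebra L Ω] [Algebra.IsAlgebraic L Ω]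
    {c : ℝ} (hc : 1 < c) (h : ∀ x : L, x ≠ 0 → ∃ n : ℤ, ‖x‖ = c ^ n) :
    HasDiscretePowers (spectralAbs L Ω) := by
  refine ⟨c, hc, fun x hx => ⟨(minpoly L x).natDegree,
    minpoly.natDegree_pos (Algebra.IsIntegral.isIntegral x), ?_⟩⟩
  obtain ⟨n, hn⟩ := h ((minpoly L x).coeff 0)
    (minpoly.coeff_zero_ne_zero (Algebra.IsIntegral.isIntegral x) hx)
  refine ⟨n, ?_⟩
  rw [← hn]
  change spectralNorm L Ω x ^ _ = _
  rw [spectralNorm.spectralNorm_eq_norm_coeff_zero_rpow, one_div, Real.rpow_inv_natCast_pow]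
  · exact norm_nonneg _
  · exact (minpoly.natDegree_pos (Algebra.IsIntegral.isIntegral x)).ne'

open scoped LaurentSeries in
-- `K` embeds in an algebraic closure of `F((X))` with `s` going to the uniformizer, whose absolute
-- value is less than `1`.
theorem exists_absoluteValue_of_transcendental {F K : Type*} [Field F] [Countable F] [Field K]
    [Countable K] [Algebra F K] {s : K} (hs : Transcendental F s) :
    ∃ v : AbsoluteValue K ℝ, HasDiscretePowers v ∧ v s ≠ 1 := by
  let L := F⸨X⸩
  let w : Valuation L (WithZero (Multiplicative ℤ)) := Valued.v
  let X : L := ((PowerSeries.X : PowerSeries F) : F⸨X⸩)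
  have hX : w X = WithZero.exp (-1 : ℤ) := by
    have h := LaurentSeries.valuation_X_pow F 1
    rw [pow_one] at h
    exact h
  have hXlt : w X < 1 := by
    rw [hX, ← WithZero.exp_zero, WithZero.exp_lt_exp]
    norm_num
  have hX0 : w X ≠ 0 := by simp [hX]
  have : w.IsNontrivial := ⟨X, hX0, hXlt.ne⟩
  obtain ⟨hrank⟩ := Valuation.nonempty_rankOne_iff_mulArchimedean (v := w) |>.mpr inferInstance
  have : Valuation.RankOne (Valued.v : Valuation L (WithZero (Multiplicative ℤ))) := hrank
  let : NontriviallyNormedField L :=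
    Valued.toNontriviallyNormedField L (WithZero (Multiplicative ℤ))
  have hXn : ‖X‖ < 1 := Valued.toNormedField.norm_lt_one_iff.mpr hXlt
  have hXne : X ≠ 0 := by
    rintro h
    exact hX0 (by rw [h, map_zero])
  have hdisc (x : L) (hx : x ≠ 0) : ∃ n : ℤ, ‖x‖ = ‖X‖⁻¹ ^ n := by
    -- The norm comes from an unspecified rank one structure, so `x` is compared with a power of `X`
    -- of the same valuation.
    refine ⟨WithZero.log (w x), ?_⟩
    have hwx : w x = w (X⁻¹ ^ WithZero.log (w x)) := by
      rw [map_zpow₀, map_inv₀, hX, ← WithZero.exp_neg, ← WithZero.exp_zsmul]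
      simp [WithZero.exp_log ((Valuation.ne_zero_iff w).mpr hx)]
    rw [← norm_inv, ← norm_zpow]
    exact le_antisymm (Valued.toNormedField.norm_le_iff.mpr hwx.le)
      (Valued.toNormedField.norm_le_iff.mpr hwx.ge)
  let Ω := AlgebraicClosure L
  have : Uncountable L := by
    rw [← Cardinal.aleph0_lt_mk_iff]
    exact Cardinal.aleph0_lt_continuum.trans_le (continuum_le_cardinal_of_nontriviallyNormedField L)
  have : Uncountable Ω := (algebraMap L Ω).injective.uncountable
  -- The variable acts as `s` on `K` and as the uniformizer on `Ω`. Transcendence of `s` makes the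
  -- first action faithful, and a map over `F[X]` sends `s` to the uniformizer.
  let i₁ : Polynomial F →+* K := (Polynomial.aeval s : Polynomial F →ₐ[F] K).toRingHom
  let i₂ : Polynomial F →+* L :=
    (algebraMap (PowerSeries F) L).comp Polynomial.coeToPowerSeries.ringHom
  let : Algebra (Polynomial F) K := i₁.toAlgebra
  let algΩ : Algebra (Polynomial F) Ω := ((algebraMap L Ω).comp i₂).toAlgebra
  have : FaithfulSMul (Polynomial F) K := (faithfulSMul_iff_algebraMap_injective _ _).mpr
    (transcendental_iff_injective.mp hs)
  have : @FaithfulSMul (Polynomial F) Ω algΩ.toSMul := (faithfulSMul_iff_algebraMap_injective _ _).mpr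
    ((algebraMap L Ω).injective.comp
      ((IsFractionRing.injective (PowerSeries F) L).comp (Polynomial.coe_injective F)))
  have : Countable (Polynomial F) := by
    rw [← Cardinal.mk_le_aleph0_iff]
    exact Polynomial.cardinalMk_le_max.trans
      (max_le (Cardinal.mk_le_aleph0_iff.mpr inferInstance) le_rfl)
  obtain ⟨σ⟩ := nonempty_algHom_of_uncountable (Polynomial F) (K := K) (Ω := Ω)
  refine ⟨(spectralAbs L Ω).comp σ.toRingHom.injective, (hasDiscretePowers_spectralAbs
    ((one_lt_inv₀ (norm_pos_iff.mpr hXne)).mpr hXn) hdisc).comp _, ?_⟩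
  have hσ : σ s = algebraMap L Ω X := by
    have h1 : algebraMap (Polynomial F) K Polynomial.X = s := Polynomial.aeval_X s
    rw [← h1, σ.commutes]
    change algebraMap L Ω (algebraMap (PowerSeries F) L (Polynomial.X : Polynomial F)) = _
    rw [Polynomial.coe_X]
    rfl
  change spectralNorm L Ω (σ s) ≠ 1
  rw [hσ, spectralNorm_extends]
  exact hXn.ne

end Discrete

/-! ### Bounded orbits for a discrete absolute value -/

section Boundedness

variable {K : Type*} [Field K]

theorem finite_zpowers_bounded {c : ℝ} (hc : 1 < c) (C : ℝ) :
    {x : ℝˣ | (∃ n : ℤ, (x : ℝ) = c ^ n) ∧ (x : ℝ) ≤ C ∧ ((x⁻¹ : ℝˣ) : ℝ) ≤ C}.Finite := by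
  obtain ⟨B, hB⟩ := pow_unbounded_of_one_lt C hc
  have hc0 : 0 < c := by linarith
  refine ((Set.finite_Icc (-(B : ℤ)) B).image fun n => (Units.mk0 c hc0.ne') ^ n).subset ?_
  rintro x ⟨⟨n, hn⟩, h1, h2⟩
  have h3 : c ^ n < c ^ (B : ℤ) := by rw [← hn]; exact_mod_cast h1.trans_lt hB
  have h4 : c ^ (-n) < c ^ (B : ℤ) := by
    rw [zpow_neg, ← hn, ← Units.val_inv_eq_inv_val]
    exact_mod_cast h2.trans_lt hB
  rw [zpow_lt_zpow_iff_right₀ hc] at h3 h4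
  refine ⟨n, ⟨by omega, by omega⟩, ?_⟩
  ext1
  simp [hn]

/-- A bounded orbit of a hyperbolic monomial map consists of points with coordinates of absolute
value `1` if the absolute value is discrete. -/
theorem eq_one_of_isBoundedFor {M : Matrix (Fin 2) (Fin 2) ℤ} (hM : IsUnit M)
    (hyp : IsHyperbolic M) {v : AbsoluteValue K ℝ} (hv : HasDiscretePowers v) {u : Kˣ × Kˣ}
    (hb : IsBoundedFor v (Set.range fun n : ℕ => act (M ^ n) u)) :
    v (u.1 : K) = 1 ∧ v (u.2 : K) = 1 := by
  obtain ⟨c, hc, hcv⟩ := hv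
  obtain ⟨C, hC⟩ := hb
  obtain ⟨N₁, hN₁, n₁, h₁⟩ := hcv u.1 u.1.ne_zero
  obtain ⟨N₂, hN₂, n₂, h₂⟩ := hcv u.2 u.2.ne_zero
  -- The `N`-th powers of both absolute values are integral powers of `c`, and so are all monomials
  -- in them.
  set N := N₁ * N₂ with hN
  have hN0 : 0 < N := Nat.mul_pos hN₁ hN₂
  have h₁' : v u.1 ^ N = c ^ (n₁ * N₂) := by
    rw [hN, pow_mul, h₁, zpow_mul, zpow_natCast]
  have h₂' : v u.2 ^ N = c ^ (n₂ * N₁) := by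
    rw [hN, mul_comm, pow_mul, h₂, zpow_mul, zpow_natCast]
  let ν : Kˣ →* ℝˣ := Units.map (v : K →* ℝ)
  let g : Kˣ →* ℝˣ := (powMonoidHom N).comp ν
  have hg (x : Kˣ) : ((g x : ℝˣ) : ℝ) = v x ^ N := rfl
  have hg' (x : Kˣ) : (((g x)⁻¹ : ℝˣ) : ℝ) = v ((x⁻¹ : Kˣ) : K) ^ N := by
    rw [← map_inv, hg]
  have hc0 : c ≠ 0 := by linarith
  have hact (P : Matrix (Fin 2) (Fin 2) ℤ) :
      (∃ n : ℤ, ((act P (Prod.map g g u)).1 : ℝ) = c ^ n) ∧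
      (∃ n : ℤ, ((act P (Prod.map g g u)).2 : ℝ) = c ^ n) := by
    constructor
    · refine ⟨n₁ * N₂ * P 0 0 + n₂ * N₁ * P 0 1, ?_⟩
      simp [act_apply, hg, h₁', h₂', zpow_add₀ hc0, zpow_mul]
    · refine ⟨n₁ * N₂ * P 1 0 + n₂ * N₁ * P 1 1, ?_⟩
      simp [act_apply, hg, h₁', h₂', zpow_add₀ hc0, zpow_mul]
  have hfin : (Set.range fun n : ℕ => act (M ^ n) (Prod.map g g u)).Finite := by
    have hS := finite_zpowers_bounded hc (C ^ N)
    refine (hS.prod hS).subset ?_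
    rintro _ ⟨n, rfl⟩
    obtain ⟨b1, b2, b3, b4⟩ := hC _ (Set.mem_range_self n)
    have ha := hact (M ^ n)
    refine ⟨⟨ha.1, ?_, ?_⟩, ⟨ha.2, ?_, ?_⟩⟩ <;> simp only [← map_act, Prod.map_fst, Prod.map_snd]
    · rw [hg]; exact pow_le_pow_left₀ (v.nonneg _) b1 _
    · rw [hg']; exact pow_le_pow_left₀ (v.nonneg _) b2 _
    · rw [hg]; exact pow_le_pow_left₀ (v.nonneg _) b3 _
    · rw [hg']; exact pow_le_pow_left₀ (v.nonneg _) b4 _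
  -- The pair of `N`-th powers of absolute values has a finite orbit, hence is torsion; a
  -- nonnegative real with a positive power equal to `1` is `1`.
  obtain ⟨k, hk, hper⟩ := exists_period_of_finite hM hfin
  obtain ⟨d, hd, hpow⟩ := exists_pow_eq_one hyp hk hper
  have key (x : Kˣ) (hx : g x ^ d = 1) : v (x : K) = 1 := by
    have := congrArg (Units.val : ℝˣ → ℝ) hx
    rw [Units.val_pow_eq_pow_val, hg, ← pow_mul, Units.val_one] at this
    exact (pow_eq_one_iff_of_nonneg (v.nonneg _) (Nat.mul_pos hN0 hd).ne').mp this
  exact ⟨key _ (congrArg Prod.fst hpow), key _ (congrArg Prod.snd hpow)⟩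

end Boundedness

/-! ### Integrality from `p`-adic absolute values -/

section Integrality

theorem exists_int_of_padicNorm_le_one {q : ℚ}
    (h : ∀ (p : ℕ) [Fact p.Prime], ‖(q : ℚ_[p])‖ ≤ 1) : ∃ z : ℤ, (z : ℚ) = q := by
  refine ⟨q.num, Rat.coe_int_num_of_den_eq_one ?_⟩
  by_contra hden
  obtain ⟨p, hp, hdvd⟩ := Nat.exists_prime_and_dvd hden
  have : Fact p.Prime := ⟨hp⟩
  have hu := PadicInt.isUnit_iff.mp (PadicInt.isUnit_den q (h p))
  have hlt : ‖((q.den : ℤ) : ℤ_[p])‖ < 1 :=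
    (PadicInt.norm_int_lt_one_iff_dvd _).mpr (Int.natCast_dvd_natCast.mpr hdvd)
  exact hlt.ne (by simpa using hu)

/-- The linear factors `X - r` have coefficients in the closed unit ball, which is a subring by the
ultrametric inequality. -/
theorem norm_coeff_le_one {Ω : Type*} [NormedField Ω] [IsUltrametricDist Ω]
    {P : Polynomial Ω} (hP : P.Monic) (hs : P.Splits) (hr : ∀ r ∈ P.roots, ‖r‖ ≤ 1) (i : ℕ) :
    ‖P.coeff i‖ ≤ 1 := by
  let O := (NormedField.valuation (K := Ω)).integer
  have hlift : P ∈ Polynomial.lifts O.subtype := by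
    rw [hs.eq_prod_roots_of_monic hP]
    refine Subsemiring.multiset_prod_mem _ _ fun Q hQ => ?_
    obtain ⟨r, hmem, rfl⟩ := Multiset.mem_map.mp hQ
    have hrO : r ∈ O := hr r hmem
    exact (Polynomial.mem_lifts _).mpr ⟨Polynomial.X - Polynomial.C ⟨r, hrO⟩, by simp⟩
  obtain ⟨y, hy⟩ := (Polynomial.lifts_iff_coeff_lifts _).mp hlift i
  rw [← hy]
  exact y.2

/-- An element of a number field all of whose `p`-adic absolute values are at most `1` is an
algebraic integer. -/
theorem isIntegral_of_padic {k : Type*} [Field k] [NumberField k] {x : k}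
    (h : ∀ (p : ℕ) [Fact p.Prime] (τ : k →+* PadicAlgCl p), ‖τ x‖ ≤ 1) : IsIntegral ℤ x := by
  have hx : IsIntegral ℚ x := Algebra.IsIntegral.isIntegral x
  have hlift : minpoly ℚ x ∈ Polynomial.lifts (Int.castRingHom ℚ) := by
    refine (Polynomial.lifts_iff_coeff_lifts _).mpr fun i => ?_
    obtain ⟨z, hz⟩ := exists_int_of_padicNorm_le_one (q := (minpoly ℚ x).coeff i) fun p _ => by
      -- The roots of the minimal polynomial in `PadicAlgCl p` are exactly the images of `x` under
      -- embeddings `τ`.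
      have h1 := norm_coeff_le_one ((minpoly.monic hx).map (algebraMap ℚ (PadicAlgCl p)))
        (IsAlgClosed.splits _) (fun r hr => by
          have hr' : r ∈ (minpoly ℚ x).rootSet (PadicAlgCl p) :=
            (Polynomial.mem_rootSet'.mpr (by simpa [Polynomial.aeval_def] using hr))
          rw [← Algebra.IsAlgebraic.range_eval_eq_rootSet_minpoly] at hr'
          obtain ⟨τ, rfl⟩ := hr'
          exact h p τ.toRingHom) i
      rw [Polynomial.coeff_map, IsScalarTower.algebraMap_apply ℚ ℚ_[p] (PadicAlgCl p)] at h1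
      rw [← PadicAlgCl.norm_extends]
      simpa using h1
    exact ⟨z, hz⟩
  obtain ⟨Q, hQ, -, hmonic⟩ := Polynomial.lifts_and_natDegree_eq_and_monic hlift (minpoly.monic hx)
  refine ⟨Q, hmonic, ?_⟩
  have h2 := minpoly.aeval ℚ x
  rw [← hQ, Polynomial.aeval_def, Polynomial.eval₂_map] at h2
  rwa [RingHom.ext_int (algebraMap ℤ k) ((algebraMap ℚ k).comp (Int.castRingHom ℚ))]

theorem hasDiscretePowers_padicAlgCl (p : ℕ) [Fact p.Prime] :
    HasDiscretePowers (spectralAbs ℚ_[p] (PadicAlgCl p)) := by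
  refine hasDiscretePowers_spectralAbs (c := p) (by exact_mod_cast (Fact.out : p.Prime).one_lt)
    fun x hx => ⟨_, Padic.norm_eq_zpow_neg_valuation hx⟩

theorem uncountable_padicAlgCl (p : ℕ) [Fact p.Prime] : Uncountable (PadicAlgCl p) := by
  have : Uncountable ℚ_[p] := by
    rw [← Cardinal.aleph0_lt_mk_iff]
    exact Cardinal.aleph0_lt_continuum.trans_le
      (continuum_le_cardinal_of_nontriviallyNormedField _)
  exact (algebraMap ℚ_[p] (PadicAlgCl p)).injective.uncountable

end Integrality

/-! ### Finiteness of orbits bounded for all absolute values -/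

section Finiteness

variable {K : Type*} [Field K] [Countable K]

/-- Through `σ`, an absolute value of `k` induced by `τ` extends to `K`, where boundedness is known.
-/
theorem exists_extension {k Ω : Type*} [Field k] [Algebra k K] [Field Ω] [IsAlgClosed Ω]
    [Uncountable Ω] (τ : k →+* Ω) : ∃ σ : K →+* Ω, ∀ x : k, σ (algebraMap k K x) = τ x := by
  let := τ.toAlgebra
  have : Countable k := (algebraMap k K).injective.countable
  obtain ⟨σ⟩ := nonempty_algHom_of_uncountable k (K := K) (Ω := Ω)
  exact ⟨σ.toRingHom, σ.commutes⟩

theorem isAlgebraic_of_isBoundedFor {M : Matrix (Fin 2) (Fin 2) ℤ} (hM : IsUnit M)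
    (hyp : IsHyperbolic M) {u : Kˣ × Kˣ}
    (hb : ∀ v : AbsoluteValue K ℝ, IsBoundedFor v (Set.range fun n : ℕ => act (M ^ n) u))
    (F : Type*) [Field F] [Algebra F K] :
    IsAlgebraic F (u.1 : K) ∧ IsAlgebraic F (u.2 : K) := by
  have : Countable F := (algebraMap F K).injective.countable
  constructor <;> by_contra htr <;>
    obtain ⟨v, hv, hne⟩ := exists_absoluteValue_of_transcendental htr
  exacts [hne (eq_one_of_isBoundedFor hM hyp hv (hb v)).1,
    hne (eq_one_of_isBoundedFor hM hyp hv (hb v)).2]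

/-- Non-archimedean boundedness gives `p`-adic absolute value `1` for `u`, hence for its whole
orbit, so all coordinates are algebraic integers. Archimedean boundedness bounds their conjugates
uniformly, and a number field has finitely many such integers. -/
theorem finite_orbit_of_numberField {M : Matrix (Fin 2) (Fin 2) ℤ} (hM : IsUnit M)
    (hyp : IsHyperbolic M) {k : Type*} [Field k] [NumberField k] [Algebra k K] {u : kˣ × kˣ}
    (hb : ∀ v : AbsoluteValue k ℝ, (∃ w : AbsoluteValue K ℝ, ∀ x, v x = w (algebraMap k K x)) →
      IsBoundedFor v (Set.range fun n : ℕ => act (M ^ n) u)) :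
    (Set.range fun n : ℕ => act (M ^ n) u).Finite := by
  have hint (n : ℕ) : IsIntegral ℤ ((act (M ^ n) u).1 : k) ∧
      IsIntegral ℤ ((act (M ^ n) u).2 : k) := by
    have key (p : ℕ) [Fact p.Prime] (τ : k →+* PadicAlgCl p) :
        ‖τ (act (M ^ n) u).1‖ = 1 ∧ ‖τ (act (M ^ n) u).2‖ = 1 := by
      have := uncountable_padicAlgCl p
      obtain ⟨σ, hσ⟩ := exists_extension (K := K) τ
      let A := spectralAbs ℚ_[p] (PadicAlgCl p)
      have h1 := eq_one_of_isBoundedFor hM hyp ((hasDiscretePowers_padicAlgCl p).comp τ)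
        (hb (A.comp τ.injective) ⟨A.comp σ.injective, fun x => congrArg A (hσ x).symm⟩)
      let ν : kˣ →* ℝˣ := Units.map ((A.comp τ.injective : AbsoluteValue k ℝ) : k →* ℝ)
      have h2 : Prod.map ν ν u = 1 := Prod.ext (Units.ext h1.1) (Units.ext h1.2)
      have h3 := map_act ν (M ^ n) u
      rw [h2, map_one] at h3
      exact ⟨congrArg (Units.val ∘ Prod.fst) h3, congrArg (Units.val ∘ Prod.snd) h3⟩
    exact ⟨isIntegral_of_padic fun p _ τ => (key p τ).1.le,
      isIntegral_of_padic fun p _ τ => (key p τ).2.le⟩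
  have harch (τ : k →+* ℂ) : ∃ C : ℝ, ∀ n : ℕ,
      ‖τ (act (M ^ n) u).1‖ ≤ C ∧ ‖τ (act (M ^ n) u).2‖ ≤ C := by
    have : Uncountable ℂ := by
      rw [← Cardinal.aleph0_lt_mk_iff, Cardinal.mk_complex]
      exact Cardinal.aleph0_lt_continuum
    obtain ⟨σ, hσ⟩ := exists_extension (K := K) τ
    let A := NormedField.toAbsoluteValue ℂ
    obtain ⟨C, hC⟩ := hb (A.comp τ.injective)
      ⟨A.comp σ.injective, fun x => congrArg A (hσ x).symm⟩
    exact ⟨C, fun n => ⟨(hC _ ⟨n, rfl⟩).1, (hC _ ⟨n, rfl⟩).2.2.1⟩⟩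
  choose C hC using harch
  obtain ⟨B, hB⟩ := (Set.finite_range C).bddAbove
  have hS := (NumberField.Embeddings.finite_of_norm_le k ℂ B).preimage
    (Units.val_injective (α := k)).injOn
  refine (hS.prod hS).subset ?_
  rintro _ ⟨n, rfl⟩
  exact ⟨⟨(hint n).1, fun τ => ((hC τ n).1).trans (hB ⟨τ, rfl⟩)⟩,
    ⟨(hint n).2, fun τ => ((hC τ n).2).trans (hB ⟨τ, rfl⟩)⟩⟩

/-- An orbit of a hyperbolic monomial map that is bounded for all absolute values is finite. -/
theorem finite_of_isBoundedFor {M : Matrix (Fin 2) (Fin 2) ℤ} (hM : IsUnit M)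
    (hyp : IsHyperbolic M) {u : Kˣ × Kˣ}
    (hb : ∀ v : AbsoluteValue K ℝ, IsBoundedFor v (Set.range fun n : ℕ => act (M ^ n) u)) :
    (Set.range fun n : ℕ => act (M ^ n) u).Finite := by
  -- For `F` the prime field, the coordinates of `u` generate a finite extension `k`, and the whole
  -- orbit comes from `k`.
  have descend (F : Type) [Field F] [Algebra F K] : ∃ (k : IntermediateField F K) (w : kˣ × kˣ),
      FiniteDimensional F k ∧
      ∀ P, act P u = Prod.map (Units.map (algebraMap k K : k →* K))
        (Units.map (algebraMap k K : k →* K)) (act P w) := by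
    obtain ⟨h1, h2⟩ := isAlgebraic_of_isBoundedFor hM hyp hb F
    have m1 : (u.1 : K) ∈ IntermediateField.adjoin F {(u.1 : K), (u.2 : K)} :=
      IntermediateField.subset_adjoin _ _ (by simp)
    have m2 : (u.2 : K) ∈ IntermediateField.adjoin F {(u.1 : K), (u.2 : K)} :=
      IntermediateField.subset_adjoin _ _ (by simp)
    refine ⟨IntermediateField.adjoin F {(u.1 : K), (u.2 : K)},
      (Units.mk0 ⟨_, m1⟩ (by simp [Subtype.ext_iff]), Units.mk0 ⟨_, m2⟩ (by simp [Subtype.ext_iff])),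
      ?_, fun P => ?_⟩
    · refine IntermediateField.finiteDimensional_adjoin fun x hx => ?_
      rcases hx with rfl | rfl
      exacts [h1.isIntegral, h2.isIntegral]
    · rw [map_act]
      exact congrArg (act P) (Prod.ext (Units.ext rfl) (Units.ext rfl))
  obtain ⟨p, hp⟩ := CharP.exists K
  rcases CharP.char_is_prime_or_zero K p with hprime | rfl
  · have : Fact p.Prime := ⟨hprime⟩
    let := ZMod.algebra K p
    obtain ⟨k, w, hk, hw⟩ := descend (ZMod p)
    -- In positive characteristic `k` is a finite field, so no absolute value is needed any more.
    have : Finite k := Module.finite_of_finite (ZMod p)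
    have hfin : (Set.range fun n : ℕ => act (M ^ n) w).Finite := Set.toFinite _
    exact (hfin.image (Prod.map _ _)).subset
      (Set.range_subset_iff.mpr fun n => ⟨_, ⟨n, rfl⟩, (hw (M ^ n)).symm⟩)
  · have : CharZero K := CharP.charP_to_charZero K
    obtain ⟨k, w, hk, hw⟩ := descend ℚ
    have : NumberField k := ⟨⟩
    have hfin := finite_orbit_of_numberField (K := K) hM hyp (u := w) fun v ⟨v', hv⟩ => by
      obtain ⟨C, hC⟩ := hb v'
      refine ⟨C, ?_⟩
      rintro _ ⟨n, rfl⟩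
      have h := hC _ ⟨n, rfl⟩
      simp only [hw] at h
      simp only [hv]
      exact h
    exact (hfin.image (Prod.map _ _)).subset
      (Set.range_subset_iff.mpr fun n => ⟨_, ⟨n, rfl⟩, (hw (M ^ n)).symm⟩)

end Finiteness

/-- The successive quotients of a bounded sequence are bounded. -/
theorem IsBoundedFor.div {K : Type*} [Field K] {v : AbsoluteValue K ℝ} {q r : ℕ → Kˣ × Kˣ}
    (hq : IsBoundedFor v (Set.range q)) (hr : IsBoundedFor v (Set.range r)) :
    IsBoundedFor v (Set.range fun n => q n / r n) := by
  obtain ⟨C, hC⟩ := hq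
  obtain ⟨D, hD⟩ := hr
  refine ⟨C * D, ?_⟩
  rintro _ ⟨n, rfl⟩
  obtain ⟨a1, a2, a3, a4⟩ := hC _ ⟨n, rfl⟩
  obtain ⟨b1, b2, b3, b4⟩ := hD _ ⟨n, rfl⟩
  have key (x y : Kˣ) (hx : v x ≤ C) (hy : v ((y⁻¹ : Kˣ) : K) ≤ D) :
      v ((x / y : Kˣ) : K) ≤ C * D := by
    rw [div_eq_mul_inv, Units.val_mul, map_mul]
    exact mul_le_mul hx hy (v.nonneg _) ((v.nonneg _).trans hx)
  refine ⟨key _ _ a1 b2, ?_, key _ _ a3 b4, ?_⟩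
  · rw [Prod.fst_div, inv_div, div_eq_mul_inv, mul_comm, ← inv_inv (r n).1, ← div_eq_mul_inv]
    exact key _ _ a2 (by simpa using b1)
  · rw [Prod.snd_div, inv_div, div_eq_mul_inv, mul_comm, ← inv_inv (r n).2, ← div_eq_mul_inv]
    exact key _ _ a4 (by simpa using b3)

end Torus

end

/-! ### Reduction to the successive quotients -/

theorem lemma5p4 {K : Type*} [Field K]
    (hK : ∃ s : Finset K, Subfield.closure (s : Set K) = ⊤)
    (f : Torus.Aut K) (hf : f.IsLoxodromic)
    (p : Kˣ × Kˣ) (hp : p ∉ Function.periodicPts f.onPoints) :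
    ∃ v : AbsoluteValue K ℝ,
      ¬ Torus.IsBoundedFor v (Set.range fun n : ℕ => f.onPoints^[n] p) := by
  by_contra! hb
  have := Torus.countable_of_closure_finset hK
  obtain ⟨c, M, hM, h⟩ := Torus.exists_matrix f
  have hyp := hf.isHyperbolic hM h
  have hf' := Torus.onPoints_eq h
  refine hp (Torus.mem_periodicPts_of_finite hM hyp hf' p
    (Torus.finite_of_isBoundedFor hM hyp fun v => ?_))
  -- The translation `c` cancels in a quotient of two successive points, which leaves the purely
  -- monomial map.
  have hquot (n : ℕ) : Torus.act (M ^ n) (f.onPoints p / p) =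
      f.onPoints^[n + 1] p / f.onPoints^[n] p := by
    induction n with
    | zero => simp
    | succ n ih =>
      rw [Torus.act_pow_succ, ih, Function.iterate_succ_apply' _ (n + 1),
        hf' (f.onPoints^[n + 1] p), map_div]
      conv_rhs => rw [Function.iterate_succ_apply' _ n, hf' (f.onPoints^[n] p)]
      conv_lhs => rw [Function.iterate_succ_apply' _ n, hf' (f.onPoints^[n] p)]
      simp [mul_div_mul_left_eq_div]
  simp only [hquot]
  obtain ⟨C, hC⟩ := hb v
  exact Torus.IsBoundedFor.div (q := fun n => f.onPoints^[n + 1] p)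
    ⟨C, fun q ⟨n, hn⟩ => hC q ⟨n + 1, hn⟩⟩ ⟨C, hC⟩
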